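/- All graphs are finite and simple. An interval is a convex set of real numbers. A graph $G=(V,E)$ is an interval graph if one can assign to each $v\in V$ an interval $I_v$ so that distinct vertices $u,v$ are adjacent exactly when $I_u\cap I_v\neq\emptyset$. Let $\omega(G)$ be the number of vertices of a largest complete subgraph of $G$. Given an order $v_1,\dots,v_n$ of all the vertices of $G$, the first-fit algorithm assigns to $v_1,\dots,v_n$ in turn the colors $f(v_1),\dots,f(v_n)$, where $f(v_k)$ is the least positive integer that is not in $\{f(v_j) : 1\le j<k,\ v_jv_k\in E\}$. Let $\chi_{FF}(G)$ be the maximum, over all orders of the vertices, of the number of colors that first-fit uses on $G$. Put \[R:=\sup\left\{\frac{\chi_{FF}(G)}{\omega(G)} \;\middle|\; G \text{ is an interval graph with nonempty vertex set}\right\},\] the supremum being taken in the extended real line. Then $5\le R$. -/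

import Mathlib

namespace FirstFit

/-- A graph is an interval graph if its vertices can be assigned intervals (convex sets of real
numbers) so that distinct vertices are adjacent exactly when their intervals meet. -/
def IsIntervalGraph {V : Type*} (G : SimpleGraph V) : Prop :=
  ∃ I : V → Set ℝ, (∀ v, Convex ℝ (I v)) ∧
    ∀ u v, G.Adj u v ↔ u ≠ v ∧ (I u ∩ I v).Nonempty

/-- The color that first-fit gives to the `k`-th presented vertex `v k`: the least positive integer
that is not the color of an earlier neighbor. -/
noncomputable def color {V : Type*} (G : SimpleGraph V) {n : ℕ} (v : Fin n → V) (k : Fin n) : ℕ :=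
  sInf {c : ℕ | 0 < c ∧ ∀ (j : Fin n) (_ : j < k), G.Adj (v j) (v k) → color G v j ≠ c}
termination_by k

/-- The number of colors that first-fit uses when the vertices are presented in the order `v`. -/
noncomputable def numColors {V : Type*} (G : SimpleGraph V) {n : ℕ} (v : Fin n → V) : ℕ :=
  (Set.range (color G v)).ncard

/-- The set of numbers of colors that first-fit uses on `G`, over all orders (enumerations
without repetition) of the vertex set. -/
def colorCounts {V : Type*} [Fintype V] (G : SimpleGraph V) : Set ℕ :=
  Set.range fun v : Fin (Fintype.card V) ≃ V => numColors G v

/-- The maximum number of colors that first-fit uses on `G`, over all vertex orders. -/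
noncomputable def chiFF {V : Type*} [Fintype V] (G : SimpleGraph V) : ℕ :=
  sSup (colorCounts G)

/-- The supremum defining `chiFF` is a maximum. -/
theorem isGreatest_chiFF {V : Type*} [Fintype V] (G : SimpleGraph V) :
    IsGreatest (colorCounts G) (chiFF G) := by
  have hfin : (colorCounts G).Finite := Set.finite_range _
  have hne : (colorCounts G).Nonempty := ⟨_, (Fintype.equivFin V).symm, rfl⟩
  exact ⟨Nat.sSup_mem hne hfin.bddAbove, fun _ hx => le_csSup hfin.bddAbove hx⟩

/-- The set in the definition of `color` is nonempty, so that its least element exists. -/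
theorem color_isLeast {V : Type*} (G : SimpleGraph V) {n : ℕ} (v : Fin n → V) (k : Fin n) :
    IsLeast {c : ℕ | 0 < c ∧ ∀ j : Fin n, j < k → G.Adj (v j) (v k) → color G v j ≠ c}
      (color G v k) := by
  have hne : {c : ℕ | 0 < c ∧
      ∀ j : Fin n, j < k → G.Adj (v j) (v k) → color G v j ≠ c}.Nonempty := by
    refine ⟨(∑ j, color G v j) + 1, Nat.succ_pos _, fun j _ _ h => ?_⟩
    have := Finset.single_le_sum (f := color G v) (fun i _ => Nat.zero_le _) (Finset.mem_univ j)
    omega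
  rw [color]
  exact ⟨Nat.sInf_mem hne, fun _ hx => Nat.sInf_le hx⟩

/-- The worst-case performance ratio of first-fit on interval graphs: the supremum of
`χ_FF(G) / ω(G)` over all finite interval graphs `G` with nonempty vertex set. It is taken in the
extended reals, where every set has a supremum. -/
noncomputable def R : EReal :=
  sSup {x : EReal | ∃ (V : Type) (_ : Fintype V) (_ : Nonempty V) (G : SimpleGraph V),
    IsIntervalGraph G ∧ x = (((chiFF G : ℝ) / (G.cliqueNum : ℝ) : ℝ) : EReal)}

end FirstFit

/-! A wall is a continuous model of a bad first-fit run: columns are positions, real levels are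
colors, and each maximal run of columns at one level is an interval. When runs are presented by
increasing level, `Supported` makes each run meet every smaller color. Restricting to the levels `m
/ N` turns a wall of width 1 and height `h` into interval graphs whose ratios are at least `N * h /
(N + B)` with `B` fixed, so `h ≤ R` (`IsWall.le_R`).

Suppose the heights of walls of width 1 had supremum `H < 5`, and let `H < r < 5`. Scaling gives
walls of width `1 - k` and height `H - r * k`. A block of thickness `k` laid over such a wall lacks
support between that height and its own bottom; the gap is filled near the ends of the block, where
one side of a line is less loaded than the other. `Fillable` measures by a ratio `c` of depths how
thick such a filling can be, and `Fillable.step` improves `c` to `1 + c ^ 2 / (r - 1)`. This map has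
no real fixed point exactly because `1 < r < 5`, so `c` can be made as large as desired, and
`exists_isWall_gt` then exceeds `H`. -/

namespace FirstFit

/-! ### Walls and operations preserving support -/

/-- A column of a wall: a finite list of half-open ranges of levels. -/
abbrev Column := List (ℝ × ℝ)

/-- The column `S` contains the level `x`. -/
def Column.Has (S : Column) (x : ℝ) : Prop := ∃ p ∈ S, p.1 ≤ x ∧ x < p.2

/-- The total length of the ranges of a column. -/
def Column.size (S : Column) : ℝ := (S.map fun p => max (p.2 - p.1) 0).sum

/-- The `i`-th column of the list `L` contains the level `x`. -/
def At (L : List Column) (i : ℕ) (x : ℝ) : Prop := ∃ S, L[i]? = some S ∧ S.Has x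

/-- A list of columns is supported if each run of consecutive columns containing a level `x`
meets every nonnegative level below `x`. -/
def Supported (L : List Column) : Prop :=
  ∀ i x, At L i x → ∀ y, 0 ≤ y → y < x →
    ∃ k, At L k y ∧ ∀ m, min i k ≤ m → m ≤ max i k → At L m x

/-- There is a supported list of columns of size at most `w` that together contain all levels in
`[0, h)`. -/
def IsWall (w h : ℝ) : Prop :=
  ∃ L : List Column, Supported L ∧ (∀ S ∈ L, S.size ≤ w) ∧ ∀ y, 0 ≤ y → y < h → ∃ i, At L i y

@[simp] theorem Column.has_cons (p : ℝ × ℝ) (S : Column) (x : ℝ) :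
    Column.Has (p :: S) x ↔ (p.1 ≤ x ∧ x < p.2) ∨ Column.Has S x := by
  simp [Column.Has]

@[simp] theorem Column.not_has_nil (x : ℝ) : ¬ Column.Has [] x := by
  simp [Column.Has]

@[simp] theorem Column.size_nil : Column.size [] = 0 := rfl

theorem Column.size_cons (p : ℝ × ℝ) (S : Column) (h : p.1 ≤ p.2) :
    Column.size (p :: S) = (p.2 - p.1) + Column.size S := by
  simp [Column.size, h]

theorem not_at_nil (i : ℕ) (x : ℝ) : ¬ At [] i x := by
  simp [At]

theorem at_append {A B : List Column} {i : ℕ} {x : ℝ} :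
    At (A ++ B) i x ↔ At A i x ∨ (A.length ≤ i ∧ At B (i - A.length) x) := by
  unfold At
  rcases lt_or_ge i A.length with h | h
  · rw [List.getElem?_append_left h]
    simp [Nat.not_le.mpr h]
  · rw [List.getElem?_append_right h]
    simp [h]

theorem At.lt_length {L : List Column} {i : ℕ} {x : ℝ} (h : At L i x) : i < L.length := by
  obtain ⟨S, hS, -⟩ := h
  exact (List.getElem?_eq_some_iff.mp hS).1

theorem exists_at_iff {L : List Column} {x : ℝ} : (∃ i, At L i x) ↔ ∃ S ∈ L, S.Has x := by
  constructor
  · rintro ⟨i, S, hS, hx⟩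
    exact ⟨S, List.mem_of_getElem? hS, hx⟩
  · rintro ⟨S, hS, hx⟩
    obtain ⟨i, hi⟩ := List.getElem?_of_mem hS
    exact ⟨i, S, hi, hx⟩

theorem at_reverse {L : List Column} {i : ℕ} {x : ℝ} (hi : i < L.length) :
    At L.reverse i x ↔ At L (L.length - 1 - i) x := by
  unfold At
  rw [List.getElem?_reverse hi]

theorem at_map_cons {L : List Column} {i : ℕ} {x : ℝ} {p : ℝ × ℝ} :
    At (L.map (p :: ·)) i x ↔ At L i x ∨ (i < L.length ∧ p.1 ≤ x ∧ x < p.2) := by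
  unfold At
  rw [List.getElem?_map]
  rcases lt_or_ge i L.length with h | h
  · simp [h, or_comm]
  · simp [Nat.not_lt.mpr h]

theorem supported_nil : Supported [] := fun i x h => absurd h (not_at_nil i x)

theorem supported_singleton_nil : Supported [[]] := by
  rintro i x ⟨S, hS, hx⟩
  have := List.mem_of_getElem? hS
  simp only [List.mem_singleton] at this
  subst this
  exact absurd hx (Column.not_has_nil x)

theorem Supported.append {A B : List Column} (hA : Supported A) (hB : Supported B) :
    Supported (A ++ B) := by
  intro i x hx y hy hyx
  rcases at_append.mp hx with h | ⟨hi, h⟩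
  · obtain ⟨k, hk, hm⟩ := hA i x h y hy hyx
    exact ⟨k, at_append.mpr (Or.inl hk), fun m h1 h2 => at_append.mpr (Or.inl (hm m h1 h2))⟩
  · obtain ⟨k, hk, hm⟩ := hB _ x h y hy hyx
    refine ⟨k + A.length, at_append.mpr (Or.inr ⟨by omega, by simpa using hk⟩),
      fun m h1 h2 => at_append.mpr (Or.inr ⟨by omega, hm _ (by omega) (by omega)⟩)⟩

theorem Supported.reverse {A : List Column} (hA : Supported A) : Supported A.reverse := by
  intro i x hx y hy hyx
  have hi := hx.lt_length
  rw [List.length_reverse] at hi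
  obtain ⟨k, hk, hm⟩ := hA _ x ((at_reverse hi).mp hx) y hy hyx
  have hk' := hk.lt_length
  refine ⟨A.length - 1 - k, (at_reverse (by omega)).mpr ?_, fun m h1 h2 => ?_⟩
  · rwa [show A.length - 1 - (A.length - 1 - k) = k by omega]
  · exact (at_reverse (by omega)).mpr (hm _ (by omega) (by omega))

/-- Adding a range of levels to a block `G` of consecutive columns preserves the support property
if every lower level occurs in the range or in `G`. -/
theorem Supported.add_range {A G D : List Column} (h : Supported (A ++ (G ++ D))) (p : ℝ × ℝ)
    (hp : ∀ y, 0 ≤ y → y < p.1 → ∃ S ∈ G, S.Has y) :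
    Supported (A ++ (G.map (p :: ·) ++ D)) := by
  have key : ∀ i x, At (A ++ (G.map (p :: ·) ++ D)) i x ↔ At (A ++ (G ++ D)) i x ∨
      (A.length ≤ i ∧ i < A.length + G.length ∧ p.1 ≤ x ∧ x < p.2) := by
    intro i x
    simp only [at_append, at_map_cons, List.length_map]
    have : i - A.length < G.length ∧ A.length ≤ i ↔ A.length ≤ i ∧ i < A.length + G.length := by
      omega
    tauto
  intro i x hx y hy hyx
  rcases (key i x).mp hx with h1 | ⟨h1, h2, h3, h4⟩
  · obtain ⟨k, hk, hm⟩ := h i x h1 y hy hyx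
    exact ⟨k, (key k y).mpr (Or.inl hk), fun m a b => (key m x).mpr (Or.inl (hm m a b))⟩
  · by_cases hyp : p.1 ≤ y
    · refine ⟨i, (key i y).mpr (Or.inr ⟨h1, h2, hyp, hyx.trans h4⟩), fun m a b => ?_⟩
      obtain rfl : m = i := by omega
      exact hx
    · obtain ⟨j, hj⟩ := exists_at_iff.mpr (hp y hy (not_le.mp hyp))
      have hjl := hj.lt_length
      refine ⟨A.length + j, (key _ y).mpr (Or.inl ?_), fun m a b =>
        (key m x).mpr (Or.inr ⟨by omega, by omega, h3, h4⟩)⟩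
      refine at_append.mpr (Or.inr ⟨by omega, at_append.mpr (Or.inl ?_)⟩)
      simpa using hj

/-- The column with all levels multiplied by `t`. -/
def Column.scale (t : ℝ) (S : Column) : Column := S.map fun p => (t * p.1, t * p.2)

theorem Column.has_scale {t : ℝ} (ht : 0 < t) {S : Column} {x : ℝ} :
    (S.scale t).Has x ↔ S.Has (x / t) := by
  simp only [Column.Has, Column.scale, List.mem_map, le_div_iff₀ ht, div_lt_iff₀ ht]
  constructor
  · rintro ⟨_, ⟨p, hp, rfl⟩, h1, h2⟩
    exact ⟨p, hp, by linarith [mul_comm t p.1], by linarith [mul_comm t p.2]⟩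
  · rintro ⟨p, hp, h1, h2⟩
    exact ⟨_, ⟨p, hp, rfl⟩, by simpa [mul_comm] using h1, by simpa [mul_comm] using h2⟩

theorem Column.size_scale {t : ℝ} (ht : 0 < t) (S : Column) : (S.scale t).size = t * S.size := by
  induction S with
  | nil => simp [Column.scale]
  | cons p S ih =>
    simp only [Column.scale, Column.size, List.map_cons, List.sum_cons, mul_add] at ih ⊢
    rw [ih, mul_max_of_nonneg _ _ ht.le, mul_zero, mul_sub]

theorem IsWall.scale {w h t : ℝ} (ht : 0 < t) (H : IsWall w h) : IsWall (t * w) (t * h) := by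
  obtain ⟨L, hL, hs, hc⟩ := H
  have key : ∀ i x, At (L.map (Column.scale t)) i x ↔ At L i (x / t) := by
    intro i x
    simp only [At, List.getElem?_map, Option.map_eq_some_iff]
    constructor
    · rintro ⟨_, ⟨S, hS, rfl⟩, hx⟩
      exact ⟨S, hS, (Column.has_scale ht).mp hx⟩
    · rintro ⟨S, hS, hx⟩
      exact ⟨_, ⟨S, hS, rfl⟩, (Column.has_scale ht).mpr hx⟩
  refine ⟨L.map (Column.scale t), ?_, ?_, ?_⟩
  · intro i x hx y hy hyx
    obtain ⟨k, hk, hm⟩ := hL i _ ((key i x).mp hx) (y / t) (by positivity)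
      (by gcongr)
    exact ⟨k, (key k y).mpr hk, fun m a b => (key m x).mpr (hm m a b)⟩
  · intro S hS
    obtain ⟨S', hS', rfl⟩ := List.mem_map.mp hS
    rw [Column.size_scale ht]
    exact mul_le_mul_of_nonneg_left (hs _ hS') ht.le
  · intro y hy hyh
    obtain ⟨i, hi⟩ := hc (y / t) (by positivity) (by rw [div_lt_iff₀ ht]; linarith)
    exact ⟨i, (key i y).mpr hi⟩

/-! ### Filling gaps across a line -/

/-- Levels are measured by their depth below `H`. Suppose that on one side of a line a set of ranges
of total length `α + β` is already present, and on the other side one of total length `α`. Then any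
block with depths in `[u, v)`, where `v - r α - β ≤ c (u - r α - β)`, can be put across
the line and be supported, provided that all parameters are small enough. -/
def Fillable (r H c : ℝ) : Prop :=
  ∃ K : ℝ, 1 ≤ K ∧ ∀ α β u v : ℝ, 0 ≤ α → 0 ≤ β → r * α + β ≤ u → u ≤ v →
    v - r * α - β ≤ c * (u - r * α - β) → K * (α + β + v) ≤ 1 →
    ∃ (Zi : List Column) (M : Column) (Zo : List Column),
      Supported (Zi ++ M :: Zo) ∧ (∀ x, H - v ≤ x → x < H - u → M.Has x) ∧
      (∀ S ∈ Zi, S.size ≤ 1 - α - β) ∧ (∀ S ∈ Zo, S.size ≤ 1 - α) ∧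
      M.size ≤ K * (α + β + v)

/-- For ratio 1 the depth condition forces `v ≤ u`, so the block is empty. -/
theorem fillable_one {r : ℝ} (hr : 0 ≤ r) (H : ℝ) : Fillable r H 1 := by
  refine ⟨1, le_rfl, fun α β u v hα hβ hu huv hv hK => ⟨[], [], [], ?_, ?_, ?_, ?_, ?_⟩⟩
  · exact supported_singleton_nil
  · intro x h1 h2
    linarith
  · simp
  · simp
  · rw [Column.size_nil]
    have : 0 ≤ r * α := mul_nonneg hr hα
    linarith

theorem size_cons_le {p : ℝ × ℝ} {G : List Column} {w w' : ℝ} (hp : p.1 ≤ p.2)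
    (hG : ∀ S ∈ G, S.size ≤ w) (hw : p.2 - p.1 + w ≤ w') :
    ∀ S ∈ G.map (p :: ·), Column.size S ≤ w' := by
  intro S hS
  obtain ⟨S', hS', rfl⟩ := List.mem_map.mp hS
  rw [Column.size_cons _ _ hp]
  linarith [hG S' hS']

/-- The block `p`, of thickness `b`, starts at the line and extends outward over a wall `W` of width
`1 - α - b`. A filling at its outer end supplies the depths just below `p`. If these do not reach
the top of `W`, a second filling at the inner end, at the line itself, supplies the rest; using the
ratio twice gives `c ^ 2`. -/
theorem Fillable.step {r H c : ℝ} (hr : 1 < r) (hr5 : r ≤ 5) (hc : 1 ≤ c)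
    (hW : ∀ k, 0 < k → k ≤ 1 → IsWall (1 - k) (H - r * k)) (h : Fillable r H c) :
    Fillable r H (1 + c ^ 2 / (r - 1)) := by
  obtain ⟨K, hK1, hK⟩ := h
  have hr1 : 0 < r - 1 := by linarith
  -- For both inner fillings the sum of parameters bounded in `Fillable` is at most `(8 + c) * s`.
  refine ⟨2 * (K * (8 + c)) + 4, by nlinarith, ?_⟩
  intro α β u v hα hβ hu huv hv hs
  have hrα : 0 ≤ r * α := by positivity
  have hrα5 : r * α ≤ 5 * α := by gcongr
  set s := α + β + v with hsdef
  have hv0 : 0 ≤ v := by linarith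
  have hs0 : 0 ≤ s := by positivity
  have hKs : 0 ≤ K * (8 + c) * s := by positivity
  have hs1 : s ≤ 1 / 4 := by nlinarith
  have hKs1 : K * (8 + c) * s ≤ 1 / 2 := by nlinarith
  obtain ⟨b, rfl⟩ : ∃ b, v = u + b := ⟨v - u, by ring⟩
  have hb0 : 0 ≤ b := by linarith
  rcases hb0.eq_or_lt with rfl | hb
  · refine ⟨[], [], [], supported_singleton_nil, fun x h1 h2 => by linarith, by simp, by simp, ?_⟩
    rw [Column.size_nil]
    positivity
  obtain ⟨U, rfl⟩ : ∃ U, u = r * α + U := ⟨u - r * α, by ring⟩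
  have hU : 0 ≤ U := by linarith
  have hcU : 0 ≤ c * U := by positivity
  have hb1 : (r - 1) * b ≤ c ^ 2 * (U - β) := by
    have h1 : b ≤ c ^ 2 / (r - 1) * (U - β) := by linarith
    rw [div_mul_eq_mul_div, le_div_iff₀ hr1] at h1
    linarith
  have hb2 : (r - 1) * b ≤ c ^ 2 * U - (c - 1) * (r - 1) * β := by
    -- Since `r - 1 ≤ 4`, this follows from `(c - 2) ^ 2 ≥ 0`.
    have h1 : (c - 1) * (r - 1) ≤ c ^ 2 := by nlinarith [sq_nonneg (c - 2)]
    have h2 := mul_le_mul_of_nonneg_right h1 hβ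
    linarith
  have hcs : c * U ≤ c * s := mul_le_mul_of_nonneg_left (by linarith) (by linarith)
  have hcs' : 1 * s ≤ c * s := mul_le_mul_of_nonneg_right hc hs0
  have hrb : r * b ≤ 5 * b := mul_le_mul_of_nonneg_right hr5 hb0
  -- the block below, supporting the outer end
  obtain ⟨Zi, M, Zo, hsup, hM, hZi, hZo, hMs⟩ := hK α b (r * α + U + b) (r * α + b + c * U) hα hb0
    (by linarith) (by linarith [mul_le_mul_of_nonneg_right hc hU]) (by apply le_of_eq; ring) (by
      refine le_trans ?_ (hKs1.trans (by norm_num))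
      rw [mul_assoc]
      gcongr
      linarith)
  have hMs' : M.size ≤ 1 / 2 := by
    refine hMs.trans (le_trans ?_ hKs1)
    rw [mul_assoc]
    gcongr
    linarith
  -- the wall below the block alone
  obtain ⟨W, hWs, hWsz, hWc⟩ := hW (α + b) (by linarith) (by linarith)
  set p : ℝ × ℝ := (H - (r * α + U + b), H - (r * α + U)) with hp
  have hp12 : p.1 ≤ p.2 := by simp only [hp]; linarith
  have hpsz : p.2 - p.1 = b := by simp only [hp]; ring
  have hZo' : ∀ G : List Column, (∀ S ∈ G, S.size ≤ 1 - α - b) →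
      ∀ S ∈ (G ++ (W ++ (Zi ++ [M]))).map (p :: ·) ++ Zo, Column.size S ≤ 1 - α := by
    intro G hG S hS
    rcases List.mem_append.mp hS with h | h
    · refine size_cons_le (w := 1 - α - b) hp12 ?_ (by linarith) S h
      simp only [List.mem_append, List.mem_singleton]
      rintro T (hT | hT | hT | rfl)
      · exact hG T hT
      · linarith [hWsz T hT]
      · exact hZi T hT
      · linarith
    · exact hZo S h
  -- This says that `M`, reaching depth `r * α + b + c * U`, meets the top of `W` at depth `r * (α +
  -- b)`.
  by_cases hcase : (r - 1) * b ≤ c * U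
  · refine ⟨[], [p], ([] ++ (W ++ (Zi ++ [M]))).map (p :: ·) ++ Zo, ?_, ?_, by simp,
      hZo' [] (by simp), ?_⟩
    · have := Supported.add_range (A := []) (G := [[]] ++ (W ++ (Zi ++ [M]))) (D := Zo)
        (by simpa using supported_singleton_nil.append (hWs.append hsup)) p ?_
      · simpa using this
      · intro y hy hyp
        by_cases hy1 : y < H - r * (α + b)
        · obtain ⟨S, hS, hSy⟩ := exists_at_iff.mp (hWc y hy hy1)
          exact ⟨S, by simp [hS], hSy⟩
        · exact ⟨M, by simp, hM y (by linarith) hyp⟩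
    · intro x h1 h2
      simp only [Column.has_cons]
      exact Or.inl ⟨h1, h2⟩
    · rw [Column.size_cons _ _ hp12, hpsz, Column.size_nil]
      nlinarith
  · push Not at hcase
    have hbβ : β < b := by
      by_contra hcon
      push Not at hcon
      have h1 : (c - 1) * (r - 1) * b ≤ (c - 1) * (r - 1) * β := by
        have : 0 ≤ (c - 1) * (r - 1) := mul_nonneg (by linarith) hr1.le
        gcongr
      have h2 : c * ((r - 1) * b) ≤ c * (c * U) := by linarith
      have h3 := le_of_mul_le_mul_left h2 (by linarith)
      linarith
    have hC : (r - 1) * (b - β) ≤ c * (c * U - (r - 1) * β) := by linarith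
    have hC0 : 0 ≤ c * U - (r - 1) * β := by
      have h1 : 0 ≤ (r - 1) * (b - β) := mul_nonneg hr1.le (by linarith)
      exact nonneg_of_mul_nonneg_right (h1.trans hC) (by linarith)
    -- the block supporting the inner end
    obtain ⟨Yi, N, Yo, hsup', hN, hYi, hYo, hNs⟩ := hK (α + β) (b - β) (r * α + b + c * U)
      (r * (α + b)) (by positivity) (by linarith) (by linarith) (by linarith) (by linarith) (by
        refine le_trans ?_ (hKs1.trans (by norm_num))
        rw [mul_assoc]
        gcongr
        linarith)
    have hNs' : N.size ≤ K * (8 + c) * s := by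
      refine hNs.trans ?_
      rw [mul_assoc]
      gcongr
      linarith
    -- Reversal puts the more loaded side `Yi` of the second filling under `p`.
    refine ⟨Yo.reverse, p :: N, (Yi.reverse ++ (W ++ (Zi ++ [M]))).map (p :: ·) ++ Zo,
      ?_, ?_, ?_, hZo' _ ?_, ?_⟩
    · have := Supported.add_range (A := Yo.reverse)
        (G := N :: (Yi.reverse ++ (W ++ (Zi ++ [M])))) (D := Zo)
        (by simpa using hsup'.reverse.append (hWs.append hsup)) p ?_
      · simpa using this
      · intro y hy hyp
        by_cases hy1 : y < H - r * (α + b)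
        · obtain ⟨S, hS, hSy⟩ := exists_at_iff.mp (hWc y hy hy1)
          exact ⟨S, by simp [hS], hSy⟩
        · by_cases hy2 : y < H - (r * α + b + c * U)
          · exact ⟨N, by simp, hN y (by linarith) hy2⟩
          · exact ⟨M, by simp, hM y (by linarith) hyp⟩
    · intro x h1 h2
      simp only [Column.has_cons]
      exact Or.inl ⟨h1, h2⟩
    · intro S hS
      linarith [hYo S (List.mem_reverse.mp hS)]
    · intro S hS
      linarith [hYi S (List.mem_reverse.mp hS)]
    · rw [Column.size_cons _ _ hp12, hpsz]
      linarith

/-- Completing the square, each step raises `c` by at least `1 - (r - 1) / 4 = (5 - r) / 4 > 0`. -/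
theorem exists_fillable_ge {r H : ℝ} (hr : 1 < r) (hr5 : r < 5)
    (hW : ∀ k, 0 < k → k ≤ 1 → IsWall (1 - k) (H - r * k)) (a : ℝ) :
    ∃ c, a ≤ c ∧ 1 ≤ c ∧ Fillable r H c := by
  have key : ∀ n : ℕ, ∃ c, 1 + n * ((5 - r) / 4) ≤ c ∧ 1 ≤ c ∧ Fillable r H c := by
    intro n
    induction n with
    | zero => exact ⟨1, by simp, le_rfl, fillable_one (by linarith) H⟩
    | succ n ih =>
      obtain ⟨c, h1, h2, h3⟩ := ih
      have hr1 : 0 < r - 1 := by linarith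
      have h4 : c + (5 - r) / 4 ≤ 1 + c ^ 2 / (r - 1) := by
        have h5 : c + (5 - r) / 4 - 1 ≤ c ^ 2 / (r - 1) := by
          rw [le_div_iff₀ hr1]
          nlinarith [sq_nonneg (c - (r - 1) / 2)]
        linarith
      refine ⟨_, ?_, ?_, h3.step hr hr5.le h2 hW⟩
      · push_cast
        linarith
      · have : 0 ≤ c ^ 2 / (r - 1) := by positivity
        linarith
  obtain ⟨n, hn⟩ := exists_nat_ge (a / ((5 - r) / 4))
  obtain ⟨c, h1, h2, h3⟩ := key n
  refine ⟨c, ?_, h2, h3⟩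
  rw [div_le_iff₀ (by linarith)] at hn
  linarith

/-! ### Walls of height approaching 5 -/

/-- If for some `r < 5` there are walls of width `1 - k` and height `H - r k` for all `k`, then
there is a wall of width `1` and height more than `H`. -/
theorem exists_isWall_gt {r H : ℝ} (hr : 1 < r) (hr5 : r < 5)
    (hW : ∀ k, 0 < k → k ≤ 1 → IsWall (1 - k) (H - r * k)) :
    ∃ h, H < h ∧ IsWall 1 h := by
  -- With `b = (2 * r - 1) * j`, this bound on `c` lets the filling reach from depth `2 * r * j` to
  -- depth `r * b`, the top of `W`.
  obtain ⟨c, hca, hc1, K, hK1, hK⟩ := exists_fillable_ge hr hr5 hW ((r - 1) * (2 * r - 1))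
  have hKc : 0 < K * (20 + c) := by positivity
  set j : ℝ := 1 / (2 * (K * (20 + c))) with hj
  have hj0 : 0 < j := by positivity
  have hjK : K * ((20 + c) * j) = 1 / 2 := by
    rw [hj]
    field_simp
  have hj1 : (20 + c) * j ≤ 1 / 2 := by
    rw [← hjK]
    exact le_mul_of_one_le_left (by positivity) hK1
  have hcj : 0 ≤ c * j := by positivity
  have hcj1 : 1 * j ≤ c * j := mul_le_mul_of_nonneg_right hc1 hj0.le
  have hrj : r * j ≤ 5 * j := mul_le_mul_of_nonneg_right hr5.le hj0.le
  have hrj1 : 1 * j ≤ r * j := mul_le_mul_of_nonneg_right hr.le hj0.le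
  set b : ℝ := 2 * (r * j) - j with hb
  have hb0 : 0 < b := by linarith
  have hcb : r * b ≤ b + c * j := by
    have := mul_le_mul_of_nonneg_right hca hj0.le
    rw [hb]
    linarith
  have hsmall : K * (0 + b + (b + c * j)) ≤ 1 / 2 := by
    rw [← hjK]
    gcongr
    linarith
  obtain ⟨Zi, M, Zo, hsup, hM, hZi, hZo, hMs⟩ := hK 0 b (2 * (r * j)) (b + c * j) le_rfl hb0.le
    (by linarith) (by linarith) (by apply le_of_eq; rw [hb]; ring) (by linarith)
  obtain ⟨W, hWs, hWsz, hWc⟩ := hW b hb0 (by linarith)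
  obtain ⟨W', hWs', hWsz', hWc'⟩ := hW (2 * j) (by linarith) (by linarith)
  set p : ℝ × ℝ := (H - 2 * (r * j), H - j) with hp
  have hp12 : p.1 ≤ p.2 := by simp only [hp]; linarith
  have hpsz : p.2 - p.1 = b := by simp only [hp]; linarith
  -- The block `q` straddles height `H`; below it, `W'` ends exactly where `p` begins.
  set q : ℝ × ℝ := (H - j, H + j) with hq
  have hq12 : q.1 ≤ q.2 := by simp only [hq]; linarith
  have hqsz : q.2 - q.1 = 2 * j := by simp only [hq]; ring
  have h1 := Supported.add_range (A := W') (G := [] :: (W ++ (Zi ++ [M]))) (D := Zo)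
    (by simpa using hWs'.append (supported_singleton_nil.append (hWs.append hsup))) p (by
      intro y hy hyp
      by_cases hy1 : y < H - r * b
      · obtain ⟨S, hS, hSy⟩ := exists_at_iff.mp (hWc y hy hy1)
        exact ⟨S, by simp [hS], hSy⟩
      · exact ⟨M, by simp, hM y (by linarith) hyp⟩)
  have hlow : ∀ y, 0 ≤ y → y < q.1 → ∃ S ∈ W' ++ [[p]], Column.Has S y := by
    intro y hy hyp
    by_cases hy1 : y < H - r * (2 * j)
    · obtain ⟨S, hS, hSy⟩ := exists_at_iff.mp (hWc' y hy hy1)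
      exact ⟨S, by simp [hS], hSy⟩
    · refine ⟨[p], by simp, ?_⟩
      rw [Column.has_cons]
      exact Or.inl ⟨by simp only [hp]; linarith, hyp⟩
  have h2 := Supported.add_range (A := []) (G := W' ++ [[p]])
    (D := (W ++ (Zi ++ [M])).map (p :: ·) ++ Zo) (by simpa using h1) q hlow
  refine ⟨H + j, by linarith, _, h2, ?_, ?_⟩
  · intro S hS
    simp only [List.nil_append, List.mem_append] at hS
    rcases hS with h | h | h
    · refine size_cons_le (w := 1 - 2 * j) hq12 ?_ (by linarith) S h
      intro T hT
      rcases List.mem_append.mp hT with hT | hT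
      · exact hWsz' T hT
      · rw [List.mem_singleton.mp hT, Column.size_cons _ _ hp12, hpsz, Column.size_nil]
        linarith
    · refine size_cons_le (w := 1 - b) hp12 ?_ (by linarith) S h
      simp only [List.mem_append, List.mem_singleton]
      rintro T (hT | hT | rfl)
      · exact hWsz T hT
      · linarith [hZi T hT]
      · linarith
    · linarith [hZo S h]
  · intro y hy hyh
    rw [exists_at_iff]
    by_cases hy1 : y < q.1
    · obtain ⟨S, hS, hSy⟩ := hlow y hy hy1
      refine ⟨q :: S, ?_, by rw [Column.has_cons]; exact Or.inr hSy⟩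
      simp only [List.nil_append, List.mem_append, List.mem_map]
      exact Or.inl ⟨S, by simpa using hS, rfl⟩
    · refine ⟨q :: [p], by simp, ?_⟩
      rw [Column.has_cons]
      exact Or.inl ⟨not_lt.mp hy1, hyh⟩

theorem isWall_one_one : IsWall 1 1 := by
  refine ⟨[[(0, 1)]], ?_, ?_, ?_⟩
  · have := Supported.add_range (A := []) (G := [[]]) (D := []) (by simpa using
      supported_singleton_nil) (0, 1) (fun y hy hy' => absurd hy' (not_lt.mpr hy))
    simpa using this
  · simp [Column.size]
  · intro y hy hy1
    exact exists_at_iff.mpr ⟨_, List.mem_singleton_self _, by simp [hy, hy1]⟩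

/-- There are walls of width `1` and of every height less than `5`. -/
theorem exists_isWall_one_gt {a : ℝ} (ha : a < 5) : ∃ h, a < h ∧ IsWall 1 h := by
  by_contra hcon
  push Not at hcon
  have hbdd : BddAbove {h | IsWall 1 h} := ⟨a, fun h hh => by
    by_contra hlt
    exact hcon h (not_le.mp hlt) hh⟩
  have hne : {h | IsWall 1 h}.Nonempty := ⟨1, isWall_one_one⟩
  set H := sSup {h | IsWall 1 h} with hH
  have hHa : H ≤ a := csSup_le hne fun h hh => by
    by_contra hlt
    exact hcon h (not_le.mp hlt) hh
  have hH1 : 1 ≤ H := le_csSup hbdd isWall_one_one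
  obtain ⟨h, hlt, hh⟩ := exists_isWall_gt (r := (H + 5) / 2) (H := H) (by linarith) (by linarith)
    (by
      intro k hk hk1
      have hHk : 0 < ((H + 5) / 2 - H) * k := mul_pos (by linarith) hk
      -- At `k = 1` scaling by `1 - k` is unavailable, but the required height is negative.
      rcases hk1.eq_or_lt with rfl | hk1
      · exact ⟨[], supported_nil, by simp, fun y hy hy' => by linarith⟩
      · have hk' : 0 < 1 - k := by linarith
        obtain ⟨h, hh, hlt⟩ := exists_lt_of_lt_csSup hne
          (show (H - (H + 5) / 2 * k) / (1 - k) < H by rw [div_lt_iff₀ hk']; linarith)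
        obtain ⟨L, hL, hs, hcov⟩ := hh.scale hk'
        refine ⟨L, hL, by simpa using hs, fun y hy hy' => hcov y hy (hy'.trans ?_)⟩
        rw [div_lt_iff₀ hk'] at hlt
        linarith)
  exact absurd (le_csSup hbdd hh) (not_le.mpr hlt)

/-! ### From walls to interval graphs -/

/-- The columns from `s` to `k` all contain the level `x`. -/
def InRun (L : List Column) (x : ℝ) (s k : ℕ) : Prop :=
  s ≤ k ∧ ∀ m, s ≤ m → m ≤ k → At L m x

/-- A run of consecutive columns containing the level `x` starts at `s`. -/
def IsStart (L : List Column) (x : ℝ) (s : ℕ) : Prop :=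
  At L s x ∧ ∀ i, i + 1 = s → ¬ At L i x

theorem exists_isStart {L : List Column} {x : ℝ} {k : ℕ} (h : At L k x) :
    ∃ s, IsStart L x s ∧ InRun L x s k := by
  induction k with
  | zero =>
    refine ⟨0, ⟨h, fun i hi => by omega⟩, le_rfl, fun m _ hm => ?_⟩
    obtain rfl : m = 0 := by omega
    exact h
  | succ k ih =>
    by_cases hk : At L k x
    · obtain ⟨s, hs, hsk, hr⟩ := ih hk
      refine ⟨s, hs, by omega, fun m h1 h2 => ?_⟩
      rcases Nat.le_succ_iff.mp h2 with h3 | rfl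
      · exact hr m h1 h3
      · exact h
    · refine ⟨k + 1, ⟨h, fun i hi => ?_⟩, le_rfl, fun m h1 h2 => ?_⟩
      · obtain rfl : i = k := by omega
        exact hk
      · obtain rfl : m = k + 1 := by omega
        exact h

theorem IsStart.le_of_inRun {L : List Column} {x : ℝ} {s s' k : ℕ} (h : IsStart L x s)
    (hr : InRun L x s k) (hr' : InRun L x s' k) : s ≤ s' := by
  by_contra hlt
  push Not at hlt
  have := hr.1
  exact h.2 (s - 1) (by omega) (hr'.2 _ (by omega) (by omega))

theorem Supported.exists_inRun {L : List Column} (hL : Supported L) {x y : ℝ} {s : ℕ}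
    (hs : IsStart L x s) (hy : 0 ≤ y) (hyx : y < x) : ∃ k, InRun L x s k ∧ At L k y := by
  obtain ⟨k, hk, hm⟩ := hL s x hs.1 y hy hyx
  have hsk : s ≤ k := by
    by_contra hlt
    push Not at hlt
    exact hs.2 (s - 1) (by omega) (hm _ (by omega) (by omega))
  exact ⟨k, ⟨hsk, fun m h1 h2 => hm m (by omega) (by omega)⟩, hk⟩

/-- The runs of the levels `m / N` with `m < n`, ordered by level. -/
abbrev Run (L : List Column) (N n : ℕ) : Type :=
  {q : Fin n ×ₗ Fin L.length // IsStart L (((ofLex q).1 : ℕ) / N) (ofLex q).2}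

/-- The index of the level of a run. -/
def Run.idx {L : List Column} {N n : ℕ} (v : Run L N n) : ℕ := (ofLex v.1).1

/-- The first column of a run. -/
def Run.start {L : List Column} {N n : ℕ} (v : Run L N n) : ℕ := (ofLex v.1).2

/-- The run `v` contains the column `k`. -/
def Run.Meets {L : List Column} {N n : ℕ} (v : Run L N n) (k : ℕ) : Prop :=
  InRun L ((v.idx : ℝ) / N) v.start k

theorem Run.isStart {L : List Column} {N n : ℕ} (v : Run L N n) :
    IsStart L ((v.idx : ℝ) / N) v.start := v.2

theorem Run.ext_of_meets {L : List Column} {N n : ℕ} {u v : Run L N n} {k : ℕ}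
    (h : u.idx = v.idx) (hu : u.Meets k) (hv : v.Meets k) : u = v := by
  have hs : u.start = v.start := by
    have hu' := u.isStart
    unfold Run.Meets at hu
    rw [h] at hu' hu
    exact le_antisymm (hu'.le_of_inRun hu hv) (v.isStart.le_of_inRun hv hu)
  exact Subtype.ext (ofLex.injective (Prod.ext (Fin.ext h) (Fin.ext hs)))

theorem Run.exists_meets {L : List Column} {N n m k : ℕ} (hm : m < n) (h : At L k ((m : ℝ) / N)) :
    ∃ v : Run L N n, v.idx = m ∧ v.Meets k := by
  obtain ⟨s, hs, hr⟩ := exists_isStart h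
  exact ⟨⟨toLex (⟨m, hm⟩, ⟨s, hs.1.lt_length⟩), hs⟩, rfl, hr⟩

theorem Run.idx_le_of_le {L : List Column} {N n : ℕ} {u v : Run L N n} (h : u ≤ v) :
    u.idx ≤ v.idx := by
  have h' : u.1 ≤ v.1 := h
  rw [Prod.Lex.le_iff] at h'
  rcases h' with h' | h'
  · exact h'.le
  · exact le_of_eq (congrArg Fin.val h'.1)

/-- The intersection graph of the runs. -/
def runGraph (L : List Column) (N n : ℕ) : SimpleGraph (Run L N n) where
  Adj u v := u ≠ v ∧ ∃ k, u.Meets k ∧ v.Meets k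
  symm := ⟨fun _ _ h => ⟨h.1.symm, h.2.imp fun _ hk => hk.symm⟩⟩
  loopless := ⟨fun _ h => h.1 rfl⟩

/-- A run becomes the real interval from its first to its last column; rounding up a common point
gives a common column. -/
theorem isIntervalGraph_runGraph (L : List Column) (N n : ℕ) :
    IsIntervalGraph (runGraph L N n) := by
  refine ⟨fun v => {t | (v.start : ℝ) ≤ t ∧ v.Meets ⌈t⌉₊}, fun v => ?_, fun u v => ?_⟩
  · rw [convex_iff_ordConnected]
    refine ⟨fun a ha b hb t ht => ⟨ha.1.trans ht.1, ?_, fun m h1 h2 => ?_⟩⟩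
    · exact ha.2.1.trans (Nat.ceil_mono ht.1)
    · exact hb.2.2 m h1 (h2.trans (Nat.ceil_mono ht.2))
  · refine and_congr_right fun _ => ⟨?_, ?_⟩
    · rintro ⟨k, hu, hv⟩
      refine ⟨k, ⟨Nat.cast_le.mpr hu.1, ?_⟩, ⟨Nat.cast_le.mpr hv.1, ?_⟩⟩ <;>
      rwa [Nat.ceil_natCast]
    · rintro ⟨t, hu, hv⟩
      exact ⟨_, hu.2, hv.2⟩

/-- A half-open range of length `l` contains at most `N * l + 1` multiples of `1 / N`. -/
theorem card_filter_has_le (S : Column) {N : ℕ} (hN : 0 < N) (n : ℕ) :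
    ((Set.ncard {m : ℕ | m < n ∧ Column.Has S ((m : ℝ) / N)} : ℕ) : ℝ) ≤ N * S.size + S.length := by
  have hN' : (0 : ℝ) < N := Nat.cast_pos.mpr hN
  induction S with
  | nil => simp
  | cons p S ih =>
    have hsub : {m : ℕ | m < n ∧ Column.Has (p :: S) ((m : ℝ) / N)} ⊆
        ↑(Finset.Ico ⌈N * p.1⌉₊ ⌈N * p.2⌉₊) ∪ {m : ℕ | m < n ∧ Column.Has S ((m : ℝ) / N)} := by
      rintro m ⟨hm, hp⟩
      rw [Column.has_cons] at hp
      rcases hp with ⟨h1, h2⟩ | hp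
      · left
        rw [le_div_iff₀ hN'] at h1
        rw [div_lt_iff₀ hN'] at h2
        rw [Finset.coe_Ico]
        exact ⟨Nat.ceil_le.mpr (by linarith), Nat.lt_ceil.mpr (by linarith)⟩
      · exact Or.inr ⟨hm, hp⟩
    have hfin : {m : ℕ | m < n ∧ Column.Has S ((m : ℝ) / N)}.Finite :=
      (Set.finite_lt_nat n).subset fun m hm => hm.1
    have h1 := (Set.ncard_le_ncard hsub ((Finset.finite_toSet _).union hfin)).trans
      (Set.ncard_union_le _ _)
    rw [Set.ncard_coe_finset, Nat.card_Ico] at h1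
    have h2 : ((⌈N * p.2⌉₊ - ⌈N * p.1⌉₊ : ℕ) : ℝ) ≤ N * max (p.2 - p.1) 0 + 1 := by
      rcases Nat.le_total ⌈N * p.2⌉₊ ⌈N * p.1⌉₊ with h | h
      · rw [Nat.sub_eq_zero_of_le h]
        have : 0 ≤ N * max (p.2 - p.1) 0 := mul_nonneg hN'.le (le_max_right _ _)
        push_cast
        linarith
      · rw [Nat.cast_sub h]
        have h3 : N * (p.2 - p.1) ≤ N * max (p.2 - p.1) 0 :=
          mul_le_mul_of_nonneg_left (le_max_left _ _) hN'.le
        have h4 : 0 ≤ N * max (p.2 - p.1) 0 := mul_nonneg hN'.le (le_max_right _ _)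
        have h5 := Nat.le_ceil (N * p.1)
        rcases le_or_gt 0 (N * p.2) with h6 | h6
        · have h7 := Nat.ceil_lt_add_one h6
          linarith
        · rw [Nat.ceil_eq_zero.mpr h6.le] at h ⊢
          push_cast
          have : (0 : ℝ) ≤ (⌈N * p.1⌉₊ : ℝ) := Nat.cast_nonneg _
          linarith
    have h3 : Column.size (p :: S) = max (p.2 - p.1) 0 + Column.size S := by
      simp [Column.size]
    rw [h3, List.length_cons]
    have h4 : ((Set.ncard {m : ℕ | m < n ∧ Column.Has (p :: S) ((m : ℝ) / N)} : ℕ) : ℝ) ≤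
        ((⌈N * p.2⌉₊ - ⌈N * p.1⌉₊ : ℕ) : ℝ) +
          (Set.ncard {m : ℕ | m < n ∧ Column.Has S ((m : ℝ) / N)} : ℕ) := by
      exact_mod_cast h1
    push_cast at h2 h4 ⊢
    linarith

/-- Helly's property: the latest starting column of a clique lies in all its runs, whose levels in
that column are distinct. -/
theorem cliqueNum_runGraph_le {L : List Column} (hs : ∀ S ∈ L, S.size ≤ 1) {N : ℕ} (hN : 0 < N)
    (n : ℕ) : ((runGraph L N n).cliqueNum : ℝ) ≤ N + (L.map List.length).sum := by
  obtain ⟨s, hs1⟩ := (runGraph L N n).exists_isNClique_cliqueNum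
  rw [← hs1.card_eq]
  rcases s.eq_empty_or_nonempty with rfl | hne
  · simp only [Finset.card_empty, Nat.cast_zero]
    positivity
  obtain ⟨v, hv, hmax⟩ := s.exists_max_image Run.start hne
  have hmeet : ∀ u ∈ s, u.Meets v.start := by
    intro u hu
    by_cases huv : u = v
    · subst huv
      refine ⟨le_rfl, fun m h1 h2 => ?_⟩
      obtain rfl : m = u.start := le_antisymm h2 h1
      exact u.isStart.1
    · obtain ⟨-, k, hk1, hk2⟩ := hs1.isClique hu hv huv
      exact ⟨hmax u hu, fun m h1 h2 => hk1.2 m h1 (h2.trans hk2.1)⟩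
  obtain ⟨S, hS, -⟩ := v.isStart.1
  have hSL := List.mem_of_getElem? hS
  have hcard : s.card ≤ Set.ncard {m : ℕ | m < n ∧ Column.Has S ((m : ℝ) / N)} := by
    rw [← Set.ncard_coe_finset]
    refine Set.ncard_le_ncard_of_injOn Run.idx ?_ ?_ ((Set.finite_lt_nat n).subset fun m hm => hm.1)
    · intro u hu
      refine ⟨(ofLex u.1).1.2, ?_⟩
      obtain ⟨S', hS', h⟩ := (hmeet u hu).2 _ (hmax u hu) le_rfl
      rw [hS, Option.some.injEq] at hS'
      rwa [hS']
    · intro u hu w hw h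
      exact Run.ext_of_meets h (hmeet u hu) (hmeet w hw)
  have h1 := card_filter_has_le S hN n
  have h2 : (s.card : ℝ) ≤ (Set.ncard {m : ℕ | m < n ∧ Column.Has S ((m : ℝ) / N)} : ℕ) :=
    Nat.cast_le.mpr hcard
  have h3 : (S.length : ℝ) ≤ (L.map List.length).sum :=
    Nat.cast_le.mpr (List.le_sum_of_mem (List.mem_map_of_mem hSL))
  have h4 : N * S.size ≤ N * 1 := mul_le_mul_of_nonneg_left (hs S hSL) (Nat.cast_nonneg _)
  linarith

/-- By induction, support gives an earlier neighbor of each smaller color, while distinct runs of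
equal level never meet. The shift is because colors start at 1. -/
theorem color_runGraph {L : List Column} (hL : Supported L) {N n : ℕ} (hN : 0 < N) {c : ℕ}
    (e : Fin c ≃o Run L N n) (k : Fin c) : color (runGraph L N n) e k = (e k).idx + 1 := by
  have hN' : (0 : ℝ) < N := Nat.cast_pos.mpr hN
  induction k using WellFoundedLT.induction with
  | ind k ih =>
    refine (color_isLeast (runGraph L N n) e k).unique ⟨⟨Nat.succ_pos _, ?_⟩, ?_⟩
    · rintro j hj ⟨hne, i, hi1, hi2⟩ hcol
      rw [ih j hj] at hcol
      exact hne (Run.ext_of_meets (by omega) hi1 hi2)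
    · rintro a ⟨ha, hall⟩
      by_contra hlt
      push Not at hlt
      have hidx : (a - 1) < (e k).idx := by omega
      obtain ⟨i, hr, hat⟩ := hL.exists_inRun (e k).isStart
        (y := ((a - 1 : ℕ) : ℝ) / N) (by positivity) (by gcongr)
      obtain ⟨u, hu, hui⟩ := Run.exists_meets (hidx.trans (ofLex (e k).1).1.2) hat
      have hlt' : u < e k := by
        by_contra hge
        have := Run.idx_le_of_le (not_lt.mp hge)
        omega
      have hj : e.symm u < k := by
        rw [← e.lt_iff_lt, e.apply_symm_apply]
        exact hlt'
      refine hall (e.symm u) hj ?_ ?_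
      · rw [e.apply_symm_apply]
        exact ⟨hlt'.ne, i, hui, hr⟩
      · rw [ih _ hj, e.apply_symm_apply, hu]
        omega

theorem IsWall.le_R {h : ℝ} (hw : IsWall 1 h) (hh : 0 < h) : (h : EReal) ≤ R := by
  classical
  obtain ⟨L, hL, hs, hcov⟩ := hw
  set B : ℕ := (L.map List.length).sum with hB
  have key : ∀ N : ℕ, 0 < N → ((N * h / (N + B) : ℝ) : EReal) ≤ R := by
    intro N hN
    have hN' : (0 : ℝ) < N := Nat.cast_pos.mpr hN
    set n := ⌈N * h⌉₊ with hn
    have hn0 : 0 < n := Nat.ceil_pos.mpr (by positivity)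
    have hex : ∀ m, m < n → ∃ v : Run L N n, v.idx = m := by
      intro m hm
      have h1 := Nat.lt_ceil.mp hm
      obtain ⟨i, hi⟩ := hcov ((m : ℝ) / N) (by positivity) (by rw [div_lt_iff₀ hN']; linarith)
      obtain ⟨v, hv, -⟩ := Run.exists_meets hm hi
      exact ⟨v, hv⟩
    obtain ⟨v₀, -⟩ := hex 0 hn0
    let e : Fin (Fintype.card (Run L N n)) ≃o Run L N n :=
      Fintype.orderIsoFinOfCardEq _ rfl
    have hchi : n ≤ chiFF (runGraph L N n) := by
      refine le_trans ?_ ((isGreatest_chiFF (runGraph L N n)).2 ⟨e.toEquiv, rfl⟩)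
      have hsub : (fun m => m + 1) '' Set.Iio n ⊆
          Set.range (color (runGraph L N n) e.toEquiv) := by
        rintro _ ⟨m, hm, rfl⟩
        obtain ⟨v, rfl⟩ := hex m hm
        refine ⟨e.symm v, ?_⟩
        have := color_runGraph hL hN e (e.symm v)
        rw [e.apply_symm_apply] at this
        exact this
      have h1 := Set.ncard_le_ncard hsub (Set.finite_range _)
      rwa [Set.ncard_image_of_injective _ (add_left_injective 1), Set.ncard_Iio_nat] at h1
    have hom : 0 < (runGraph L N n).cliqueNum := by
      have : (runGraph L N n).IsClique (({v₀} : Finset (Run L N n)) : Set (Run L N n)) := by simp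
      exact lt_of_lt_of_le (by simp) this.card_le_cliqueNum
    have hom' : (0 : ℝ) < (runGraph L N n).cliqueNum := Nat.cast_pos.mpr hom
    refine le_trans ?_ (le_sSup ⟨Run L N n, inferInstance, ⟨v₀⟩, runGraph L N n,
      isIntervalGraph_runGraph L N n, rfl⟩)
    rw [EReal.coe_le_coe_iff]
    have h1 : N * h ≤ chiFF (runGraph L N n) :=
      (Nat.le_ceil _).trans (Nat.cast_le.mpr hchi)
    have h2 := cliqueNum_runGraph_le hs hN n
    exact div_le_div₀ (Nat.cast_nonneg _) h1 hom' h2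
  by_contra hlt
  obtain ⟨q, hq1, hq2⟩ := EReal.lt_iff_exists_real_btwn.mp (not_le.mp hlt)
  rw [EReal.coe_lt_coe_iff] at hq2
  -- The inequality `q ≤ N * h / (N + B)` amounts to `q * B ≤ N * (h - q)`.
  obtain ⟨N, hN⟩ := exists_nat_gt (|q| * B / (h - q))
  have hN0 : (0 : ℝ) < N := lt_of_le_of_lt (div_nonneg (by positivity) (by linarith)) hN
  have h1 := key N (Nat.cast_pos.mp hN0)
  rw [div_lt_iff₀ (by linarith)] at hN
  have h2 : q ≤ N * h / (N + B) := by
    rw [le_div_iff₀ (by positivity)]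
    have : q * B ≤ |q| * B := mul_le_mul_of_nonneg_right (le_abs_self q) (Nat.cast_nonneg _)
    linarith
  exact absurd ((EReal.coe_le_coe_iff.mpr h2).trans h1) (not_le.mpr hq1)

end FirstFit

theorem theorem4p8 : (5 : EReal) ≤ FirstFit.R := by
  by_contra hlt
  obtain ⟨q, hq1, hq2⟩ := EReal.lt_iff_exists_real_btwn.mp (not_le.mp hlt)
  have hq5 : q < 5 := EReal.coe_lt_coe_iff.mp (hq2.trans_eq (by rfl))
  obtain ⟨h, hh, hw⟩ := FirstFit.exists_isWall_one_gt (max_lt hq5 (by norm_num : (0 : ℝ) < 5))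
  have h1 := hw.le_R ((le_max_right _ _).trans_lt hh)
  have h2 : (q : EReal) ≤ h := EReal.coe_le_coe_iff.mpr ((le_max_left _ _).trans hh.le)
  exact absurd (h2.trans h1) (not_le.mpr hq1)
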